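/- Let $\mathcal T_h=\{T_1,\dots,T_{n}\}$ be a finite conforming tetrahedral grid in $\mathbb R^3$: the $T$'s are distinct nondegenerate closed tetrahedra, and any two of them meet exactly in the convex hull of their common vertices. Let $\Omega$ be the interior of $\bigcup_{T\in\mathcal T_h}T$. On each $T$ fix an arbitrary numbering $\mathbf p_0,\mathbf p_1,\mathbf p_2,\mathbf p_3$ of its vertices. Conforming functions. Let $\{l_a\}$ be the Lagrange nodal basis of the continuous piecewise $P_3$ functions on $\mathcal T_h$, indexed by the cubic Lagrange nodes $a$ of the grid (all vertices, two nodes on each edge, one on each face triangle), and let $\mathbf e_1,\mathbf e_2,\mathbf e_3$ be the standard basis of $\mathbb R^3$. Bubbles. Let $\hat{\mathbf b}=(\hat b_1,\hat b_2,\hat b_3)^T\in[P_4]^3$ be the following polynomial in $(x,y,z)$: $$\hat b_1=\tfrac{263}{12}x^4+38x^3y+\tfrac{265}{3}x^3z+29x^2y^2+96x^2yz+\tfrac{209}{2}x^2z^2-16xy^3+42xy^2z +42xyz^2+\tfrac{103}{3}xz^3+\tfrac{7}{6}y^4-y^2z^2-\tfrac{335}{12}z^4-\tfrac{253}{6}x^3-\tfrac{87}{2}x^2y-119x^2z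 +\tfrac{21}{2}xy^2-56xyz-65xz^2+\tfrac{112}{3}z^3+\tfrac{703}{28}x^2+\tfrac{7}{2}xy+\tfrac{251}{7}xz-\tfrac{41}{28}y^2 +\tfrac{2}{7}yz-\tfrac{169}{14}z^2-\tfrac{181}{42}x+\tfrac{13}{21}y+\tfrac{73}{840},$$ $$\hat b_2=-\tfrac{233}{3}x^3y+\tfrac{67}{9}x^3z-\tfrac{233}{2}x^2y^2-235x^2yz+\tfrac{163}{6}x^2z^2-\tfrac{203}{3}xy^3-225xy^2z-209xyz^2 +\tfrac{301}{9}xz^3-\tfrac{64}{3}y^3z-21y^2z^2-\tfrac{16}{3}yz^3+\tfrac{113}{18}x^3+\tfrac{1105}{8}x^2y+\tfrac{155}{24}x^2z+\tfrac{1025}{8}xy^2 +\tfrac{1077}{4}xyz-\tfrac{469}{24}xz^2+\tfrac{79}{8}y^3+\tfrac{417}{8}y^2z+\tfrac{289}{8}yz^2-\tfrac{199}{72}z^3-\tfrac{625}{56}x^2-\tfrac{505}{7}xy -\tfrac{94}{7}xz-\tfrac{447}{28}y^2-\tfrac{251}{7}yz+\tfrac{317}{56}x+\tfrac{625}{84}y+\tfrac{101}{42}z-\tfrac{383}{630},$$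 $$\hat b_3=-10x^3y-10x^3z+x^2y^2+119x^2yz-15x^2z^2+16xy^3+145xy^2z+129xyz^2 +16y^3z+11y^2z^2-\tfrac{29}{4}z^4-\tfrac{93}{8}x^2y-\tfrac{61}{8}x^2z-\tfrac{301}{8}xy^2-\tfrac{693}{4}xyz-\tfrac{141}{8}xz^2 -\tfrac{13}{4}y^3-\tfrac{321}{8}y^2z-\tfrac{193}{8}yz^2+\tfrac{77}{8}z^3+\tfrac{181}{56}x^2+\tfrac{363}{14}xy+\tfrac{307}{14}xz+\tfrac{389}{56}y^2 +\tfrac{199}{7}yz-\tfrac{563}{168}x-\tfrac{33}{8}y-\tfrac{263}{84}z+\tfrac{103}{210}.$$ For $T\in\mathcal T_h$ and $i=1,\dots,9$ let $\mathbf F_i$ be the affine map sending the points $\mathbf 0,\mathbf e_1,\mathbf e_2,\mathbf e_3$, in this order, to the vertices of $T$ in the order $$0123,\ 0231,\ 0312,\ 1203,\ 1032,\ 1320,\ 2013,\ 2301,\ 3021$$ (for $i=1,\dots,9$ respectively, $k$ standing for $\mathbf p_k$), let $J_i$ be its Jacobi matrix, and put $\mathbf b_{T,i}(\mathbf x)=J_i\,\hat{\mathbf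 b}(\mathbf F_i^{-1}(\mathbf x))$ on $T$ and $\mathbf b_{T,i}=\mathbf 0$ outside $T$. Space and form. For real coefficients $c=(c_{a,m})$ and $d=(d_{T,i})$ put $$\mathbf v_c=\sum_a\sum_{m=1}^3 c_{a,m}\,l_a\mathbf e_m,\qquad \mathbf v_b=\sum_{T\in\mathcal T_h}\sum_{i=1}^9 d_{T,i}\,\mathbf b_{T,i},$$ call $c$ admissible if $\mathbf v_c=\mathbf 0$ on $\partial\Omega$, and let $\mathbf V_h=\{\mathbf v_c+\mathbf v_b:\ c \text{ admissible}, d \text{ arbitrary}\}$. Let $$(\nabla\mathbf u_h,\nabla\mathbf v_h)=\sum_{T\in\mathcal T_h}\int_T\nabla\mathbf u_h:\nabla\mathbf v_h\,d\mathbf x .$$ Lemma. The form $(\nabla\mathbf u_h,\nabla\mathbf v_h)$ is positive definite on the coefficients of $\mathbf V_h$: if $c$ is admissible and $(c,d)\ne(0,0)$, then $\mathbf v_h=\mathbf v_c+\mathbf v_b$ satisfies $(\nabla\mathbf v_h,\nabla\mathbf v_h)>0$. Consequently every $\mathbf v_h\in\mathbf V_h$ has exactly one representation $\mathbf v_h=\mathbf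 v_c+\mathbf v_b$ with $c$ admissible (the bubbles are linearly independent of the conforming $P_3$ functions with zero boundary values), and $(\nabla\mathbf u_h,\nabla\mathbf v_h)$ is an inner product on $\mathbf V_h$, so that $(\nabla\mathbf v_h,\nabla\mathbf v_h)^{1/2}$ is a norm on $\mathbf V_h$. -/

import Mathlib

noncomputable section

namespace StokesP3

/-- Three-dimensional space in Cartesian coordinates (no norm is used, only the topology,
Lebesgue measure and partial derivatives). -/
abbrev R3 : Type := Fin 3 → ℝ

/-! ### The reference bubble on the unit tetrahedron -/

/-- Component 1 of the reference bubble. -/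
def bHat1 (x y z : ℝ) : ℝ :=
  263 / 12 * x ^ 4 + 38 * x ^ 3 * y + 265 / 3 * x ^ 3 * z + 29 * x ^ 2 * y ^ 2 +
  96 * x ^ 2 * y * z + 209 / 2 * x ^ 2 * z ^ 2 - 16 * x * y ^ 3 + 42 * x * y ^ 2 * z +
  42 * x * y * z ^ 2 + 103 / 3 * x * z ^ 3 + 7 / 6 * y ^ 4 - y ^ 2 * z ^ 2 - 335 / 12 * z ^ 4 -
  253 / 6 * x ^ 3 - 87 / 2 * x ^ 2 * y - 119 * x ^ 2 * z + 21 / 2 * x * y ^ 2 -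
  56 * x * y * z - 65 * x * z ^ 2 + 112 / 3 * z ^ 3 + 703 / 28 * x ^ 2 + 7 / 2 * x * y +
  251 / 7 * x * z - 41 / 28 * y ^ 2 + 2 / 7 * y * z - 169 / 14 * z ^ 2 - 181 / 42 * x +
  13 / 21 * y + 73 / 840

/-- Component 2 of the reference bubble. -/
def bHat2 (x y z : ℝ) : ℝ :=
  -233 / 3 * x ^ 3 * y + 67 / 9 * x ^ 3 * z - 233 / 2 * x ^ 2 * y ^ 2 - 235 * x ^ 2 * y * z +
  163 / 6 * x ^ 2 * z ^ 2 - 203 / 3 * x * y ^ 3 - 225 * x * y ^ 2 * z - 209 * x * y * z ^ 2 +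
  301 / 9 * x * z ^ 3 - 64 / 3 * y ^ 3 * z - 21 * y ^ 2 * z ^ 2 - 16 / 3 * y * z ^ 3 +
  113 / 18 * x ^ 3 + 1105 / 8 * x ^ 2 * y + 155 / 24 * x ^ 2 * z + 1025 / 8 * x * y ^ 2 +
  1077 / 4 * x * y * z - 469 / 24 * x * z ^ 2 + 79 / 8 * y ^ 3 + 417 / 8 * y ^ 2 * z +
  289 / 8 * y * z ^ 2 - 199 / 72 * z ^ 3 - 625 / 56 * x ^ 2 - 505 / 7 * x * y - 94 / 7 * x * z -
  447 / 28 * y ^ 2 - 251 / 7 * y * z + 317 / 56 * x + 625 / 84 * y + 101 / 42 * z -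
  383 / 630

/-- Component 3 of the reference bubble. -/
def bHat3 (x y z : ℝ) : ℝ :=
  -10 * x ^ 3 * y - 10 * x ^ 3 * z + x ^ 2 * y ^ 2 + 119 * x ^ 2 * y * z - 15 * x ^ 2 * z ^ 2 +
  16 * x * y ^ 3 + 145 * x * y ^ 2 * z + 129 * x * y * z ^ 2 + 16 * y ^ 3 * z +
  11 * y ^ 2 * z ^ 2 - 29 / 4 * z ^ 4 - 93 / 8 * x ^ 2 * y - 61 / 8 * x ^ 2 * z -
  301 / 8 * x * y ^ 2 - 693 / 4 * x * y * z - 141 / 8 * x * z ^ 2 - 13 / 4 * y ^ 3 -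
  321 / 8 * y ^ 2 * z - 193 / 8 * y * z ^ 2 + 77 / 8 * z ^ 3 + 181 / 56 * x ^ 2 +
  363 / 14 * x * y + 307 / 14 * x * z + 389 / 56 * y ^ 2 + 199 / 7 * y * z - 563 / 168 * x -
  33 / 8 * y - 263 / 84 * z + 103 / 210

/-- The reference `P₄` bubble on the unit reference tetrahedron. -/
def bHat (x : R3) : R3 :=
  ![bHat1 (x 0) (x 1) (x 2), bHat2 (x 0) (x 1) (x 2), bHat3 (x 0) (x 1) (x 2)]

/-! ### Affine maps from the reference tetrahedron -/

/-- Jacobi matrix of the affine map sending the reference vertices `0, e₁, e₂, e₃` to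
`p 0, p 1, p 2, p 3`. -/
def jac (p : Fin 4 → R3) : Matrix (Fin 3) (Fin 3) ℝ :=
  Matrix.of fun r j => p j.succ r - p 0 r

/-- The affine map sending the reference vertices `0, e₁, e₂, e₃` to `p 0, p 1, p 2, p 3`. -/
def refMap (p : Fin 4 → R3) (x : R3) : R3 := p 0 + (jac p).mulVec x

/-- The inverse of `refMap p` (for affinely independent `p`). -/
def refMapInv (p : Fin 4 → R3) (x : R3) : R3 := (jac p)⁻¹.mulVec (x - p 0)

theorem jac_det_isUnit {p : Fin 4 → R3} (hp : AffineIndependent ℝ p) : IsUnit (jac p).det := by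
  rw [affineIndependent_iff_linearIndependent_vsub ℝ p 0] at hp
  have h : LinearIndependent ℝ (jac p).col := by
    have := hp.comp (fun j : Fin 3 => (⟨j.succ, Fin.succ_ne_zero j⟩ : {i : Fin 4 // i ≠ 0}))
      (fun a b h => Fin.succ_injective _ (congrArg Subtype.val h))
    exact this
  rw [Matrix.linearIndependent_cols_iff_isUnit] at h
  exact (Matrix.isUnit_iff_isUnit_det _).1 h

theorem refMap_refMapInv {p : Fin 4 → R3} (hp : AffineIndependent ℝ p) (x : R3) :
    refMap p (refMapInv p x) = x := by
  simp [refMap, refMapInv, Matrix.mulVec_mulVec, Matrix.mul_nonsing_inv _ (jac_det_isUnit hp)]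

theorem refMapInv_refMap {p : Fin 4 → R3} (hp : AffineIndependent ℝ p) (x : R3) :
    refMapInv p (refMap p x) = x := by
  simp [refMap, refMapInv, Matrix.mulVec_mulVec, Matrix.nonsing_inv_mul _ (jac_det_isUnit hp)]

/-- The barycentric coordinates of `x` with respect to the tetrahedron with vertices `p`. -/
def bary (p : Fin 4 → R3) (i : Fin 4) (x : R3) : ℝ :=
  (Fin.cons (1 - ∑ j, refMapInv p x j) (refMapInv p x) : Fin 4 → ℝ) i

/-- The nine numberings of the vertices of one tetrahedron: with the vertices named
`1, 6, 7, 2` in positions `0, 1, 2, 3`, these are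
`1672, 1726, 1267, 6712, 6127, 6271, 7162, 7216, 2176`. -/
def numbering : Fin 9 → Fin 4 → Fin 4 :=
  ![![0, 1, 2, 3], ![0, 2, 3, 1], ![0, 3, 1, 2],
    ![1, 2, 0, 3], ![1, 0, 3, 2], ![1, 3, 2, 0],
    ![2, 0, 1, 3], ![2, 3, 0, 1], ![3, 0, 2, 1]]

/-- The Piola image `J b̂(F⁻¹ x)` of the reference bubble on the tetrahedron with vertices `p`. -/
def piolaBubble (p : Fin 4 → R3) (x : R3) : R3 := (jac p).mulVec (bHat (refMapInv p x))

/-! ### Local cubic Lagrange basis -/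

/-- The twenty multi-indices `k = (k₀, k₁, k₂, k₃)` with `k₀ + k₁ + k₂ + k₃ = 3`. -/
def multiIdx : Finset (Fin 4 → ℕ) := Finset.Nat.antidiagonalTuple 4 3

/-- The cubic Lagrange node with barycentric coordinates `k / 3`. -/
def localNode (p : Fin 4 → R3) (k : Fin 4 → ℕ) : R3 := ∑ i, ((k i : ℝ) / 3) • p i

/-- The cubic Lagrange polynomial on the tetrahedron `p` that is `1` at the node `k` and `0` at
the other nineteen nodes. -/
def localNodal (p : Fin 4 → R3) (k : Fin 4 → ℕ) (x : R3) : ℝ :=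
  ∏ i, ∏ m ∈ Finset.range (k i), (3 * bary p i x - m) / (m + 1)

/-! ### Tetrahedral grids and the finite element space -/

/-- A (conforming) tetrahedral grid of `n` distinct nondegenerate closed tetrahedra, each with a
numbering of its vertices. Any two tetrahedra meet exactly in the convex hull of their common
vertices, i.e. in the empty set, a common vertex, a common edge or a common face. -/
structure TetMesh (n : ℕ) where
  /-- the vertices of each tetrahedron -/
  vert : Fin n → Fin 4 → R3
  affineIndependent : ∀ t, AffineIndependent ℝ (vert t)
  distinct : Function.Injective fun t => Set.range (vert t)
  conforming : ∀ s t, convexHull ℝ (Set.range (vert s)) ∩ convexHull ℝ (Set.range (vert t)) =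
    convexHull ℝ (Set.range (vert s) ∩ Set.range (vert t))

namespace TetMesh

variable {n : ℕ} (M : TetMesh n)

/-- The closed tetrahedron number `t`. -/
def tet (t : Fin n) : Set R3 := convexHull ℝ (Set.range (M.vert t))

/-- The open polyhedral domain that is covered by the grid. -/
def domain : Set R3 := interior (⋃ t, M.tet t)

/-- The cubic Lagrange nodes of the grid: the vertices, two nodes on each edge and one on each
face triangle. -/
def nodes : Finset R3 := Finset.univ.biUnion fun t => multiIdx.image (localNode (M.vert t))

open Classical in
/-- The Lagrange nodal basis function of the node `a`: the continuous function on the closed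
domain, cubic on each tetrahedron, that is `1` at `a` and `0` at all other nodes. It is computed
in some tetrahedron containing `x`; by conformity the value does not depend on which.
It is extended by zero outside the closed domain. -/
def nodal (a : R3) (x : R3) : ℝ :=
  if h : ∃ t, x ∈ M.tet t then
    ∑ k ∈ multiIdx with localNode (M.vert h.choose) k = a, localNodal (M.vert h.choose) k x
  else 0

/-- The `i`-th bubble on the tetrahedron `t`, zero outside that tetrahedron. -/
def bubble (t : Fin n) (i : Fin 9) : R3 → R3 :=
  (M.tet t).indicator (piolaBubble (M.vert t ∘ numbering i))

/-- The conforming part `∑ c_{a,m} l_a e_m` over all nodes `a` and `m = 1, 2, 3`. -/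
def conformingPart (c : M.nodes → Fin 3 → ℝ) : R3 → R3 :=
  ∑ a : M.nodes, ∑ m : Fin 3, c a m • fun x => M.nodal a x • (Pi.single m 1 : R3)

/-- The bubble part `∑_T ∑_{i=1}^9 d_{T,i} b_{T,i}`. -/
def bubblePart (d : Fin n → Fin 9 → ℝ) : R3 → R3 :=
  ∑ t : Fin n, ∑ i : Fin 9, d t i • M.bubble t i

/-- The coefficients `c` of the conforming part are admissible if that part vanishes on the
boundary of the domain. -/
def Admissible (c : M.nodes → Fin 3 → ℝ) : Prop :=
  ∀ x ∈ frontier M.domain, M.conformingPart c x = 0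

/-- The nonconforming velocity space. -/
def Vh : Submodule ℝ (R3 → R3) where
  carrier := {v | ∃ (c : M.nodes → Fin 3 → ℝ) (d : Fin n → Fin 9 → ℝ),
    M.Admissible c ∧ v = M.conformingPart c + M.bubblePart d}
  zero_mem' := ⟨0, 0, fun x _ => by simp [conformingPart], by simp [conformingPart, bubblePart]⟩
  add_mem' := by
    rintro _ _ ⟨c, d, hc, rfl⟩ ⟨c', d', hc', rfl⟩
    have h : M.conformingPart (c + c') = M.conformingPart c + M.conformingPart c' := by
      simp only [conformingPart, Pi.add_apply, add_smul, Finset.sum_add_distrib]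
    have h' : M.bubblePart (d + d') = M.bubblePart d + M.bubblePart d' := by
      simp only [bubblePart, Pi.add_apply, add_smul, Finset.sum_add_distrib]
    refine ⟨c + c', d + d', fun x hx => ?_, ?_⟩
    · rw [h, Pi.add_apply, hc x hx, hc' x hx, add_zero]
    · rw [h, h', add_add_add_comm]
  smul_mem' := by
    rintro r _ ⟨c, d, hc, rfl⟩
    have h : M.conformingPart (r • c) = r • M.conformingPart c := by
      simp only [conformingPart, Pi.smul_apply, smul_assoc, Finset.smul_sum]
    have h' : M.bubblePart (r • d) = r • M.bubblePart d := by
      simp only [bubblePart, Pi.smul_apply, smul_assoc, Finset.smul_sum]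
    refine ⟨r • c, r • d, fun x hx => ?_, ?_⟩
    · rw [h, Pi.smul_apply, hc x hx, smul_zero]
    · rw [h, h', smul_add]

/-- The form `(∇u, ∇v) = ∑_T ∫_T ∇u : ∇v`, with the gradient taken tetrahedron by tetrahedron. -/
def gradForm (u v : R3 → R3) : ℝ :=
  ∑ t : Fin n, ∫ x in interior (M.tet t), ∑ m : Fin 3, ∑ r : Fin 3,
    fderiv ℝ u x (Pi.single r 1) m * fderiv ℝ v x (Pi.single r 1) m

end TetMesh

end StokesP3

end

/-! ### Barycentric coordinates and smoothness of the local shape functions -/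

namespace StokesP3

open Finset

/-! The form is a sum of integrals of squares, so it is nonnegative, and everything reduces to
showing that zero energy forces `c = 0` and `d = 0` (`eq_zero_of_gradForm_self`). If the energy
vanishes, the gradient vanishes inside every tetrahedron, and `v_c + v_b` is constant there.

Bubbles: on one tetrahedron `v_c` is cubic, so a fourth difference along a line annihilates it and
sees only the quartic part of the bubbles. Pulled back to the reference tetrahedron, this quartic
part no longer depends on `T`. Evaluating it along the three edges that meet at one vertex gives
nine linear equations for the nine coefficients `d_{T,i}`. The system is nonsingular, so `d = 0`
(`eq_zero_of_bubbleTop`, `eq_zero_of_add_piolaBubble_const`).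

Conforming part: now `v_c` is constant on each closed tetrahedron. If it took a nonzero value, the
union of the tetrahedra carrying that value would avoid the boundary, hence be open as well as
compact, which is impossible in `R3` (`eq_zero_of_const_on_tet`). Thus `v_c` vanishes on the grid,
and its nodal values `c` are zero.

Uniqueness of the representation follows by applying this to a difference, and definiteness of the
inner product is the same statement. -/

/-- The affine basis formed by the vertices of a nondegenerate tetrahedron. -/
noncomputable def vertexBasis (p : Fin 4 → R3) (hp : AffineIndependent ℝ p) :
    AffineBasis (Fin 4) ℝ R3 :=
  ⟨p, hp, by
    rw [hp.affineSpan_eq_top_iff_card_eq_finrank_add_one]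
    simp⟩

@[simp] theorem coe_vertexBasis {p : Fin 4 → R3} (hp : AffineIndependent ℝ p) :
    ⇑(vertexBasis p hp) = p := rfl

theorem sum_bary (p : Fin 4 → R3) (x : R3) : ∑ i, bary p i x = 1 := by
  simp [bary, Fin.sum_univ_succ]

theorem sum_bary_smul {p : Fin 4 → R3} (hp : AffineIndependent ℝ p) (x : R3) :
    ∑ i, bary p i x • p i = x := by
  conv_rhs => rw [← refMap_refMapInv hp x]
  ext r
  rw [Fin.sum_univ_succ]
  simp only [bary, refMap, jac, Fin.cons_zero, Fin.cons_succ, Pi.add_apply, Pi.smul_apply,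
    smul_eq_mul, Matrix.mulVec_eq_sum, Matrix.transpose_apply, Matrix.of_apply,
    MulOpposite.smul_eq_mul_unop, MulOpposite.unop_op, Fin.sum_univ_three]
  ring

theorem bary_eq_of_sum {p : Fin 4 → R3} (hp : AffineIndependent ℝ p) {w : Fin 4 → ℝ}
    (hw : ∑ i, w i = 1) (j : Fin 4) : bary p j (∑ i, w i • p i) = w j := by
  have h := sum_bary_smul hp (∑ i, w i • p i)
  have h1 := (affineIndependent_iff_eq_of_fintype_affineCombination_eq ℝ p).1 hp
    (fun i => bary p i (∑ i, w i • p i)) w (sum_bary _ _) hw (by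
      rw [Finset.affineCombination_eq_linear_combination _ _ _ (sum_bary _ _),
        Finset.affineCombination_eq_linear_combination _ _ _ hw, h])
  exact congrFun h1 j

/-- Weights of affine combinations of independent points are unique. The identification with
`AffineBasis.coord` turns membership in a tetrahedron, or in its interior, into sign conditions on
`bary`. -/
theorem bary_eq_coord {p : Fin 4 → R3} (hp : AffineIndependent ℝ p) (i : Fin 4) (x : R3) :
    bary p i x = (vertexBasis p hp).coord i x := by
  have h := (vertexBasis p hp).linear_combination_coord_eq_self x
  conv_lhs => rw [← h]
  exact bary_eq_of_sum hp ((vertexBasis p hp).sum_coord_apply_eq_one x) i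

theorem mem_convexHull_iff_bary {p : Fin 4 → R3} (hp : AffineIndependent ℝ p) {x : R3} :
    x ∈ convexHull ℝ (Set.range p) ↔ ∀ i, 0 ≤ bary p i x := by
  have := (vertexBasis p hp).convexHull_eq_nonneg_coord
  simp only [coe_vertexBasis] at this
  simp [this, bary_eq_coord hp]

theorem mem_interior_convexHull_iff_bary {p : Fin 4 → R3} (hp : AffineIndependent ℝ p)
    {x : R3} : x ∈ interior (convexHull ℝ (Set.range p)) ↔ ∀ i, 0 < bary p i x := by
  have := (vertexBasis p hp).interior_convexHull
  simp only [coe_vertexBasis] at this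
  simp [this, bary_eq_coord hp]

theorem bary_comp_equiv {p : Fin 4 → R3} (hp : AffineIndependent ℝ p) (σ : Equiv.Perm (Fin 4))
    (i : Fin 4) (x : R3) : bary (p ∘ σ) i x = bary p (σ i) x := by
  have h : ∑ i, bary p (σ i) x • (p ∘ σ) i = x := by
    rw [← sum_bary_smul hp x]
    simpa [sum_bary_smul hp] using Equiv.sum_comp σ fun i => bary p i x • p i
  conv_lhs => rw [← h]
  exact bary_eq_of_sum (hp.comp_embedding σ.toEmbedding)
    ((Equiv.sum_comp σ fun i => bary p i x).trans (sum_bary p x)) i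

theorem bary_vertex {p : Fin 4 → R3} (hp : AffineIndependent ℝ p) (i j : Fin 4) :
    bary p i (p j) = if i = j then 1 else 0 := by
  rw [bary_eq_coord hp]
  exact (vertexBasis p hp).coord_apply i j

theorem bary_refMap {p : Fin 4 → R3} (hp : AffineIndependent ℝ p) (i : Fin 4) (y : R3) :
    bary p i (refMap p y) = (Fin.cons (1 - ∑ j, y j) y : Fin 4 → ℝ) i := by
  simp [bary, refMapInv_refMap hp]

theorem contDiff_refMapInv (p : Fin 4 → R3) {n : WithTop ℕ∞} : ContDiff ℝ n (refMapInv p) :=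
  ((Matrix.mulVecLin (jac p)⁻¹).toContinuousLinearMap.contDiff).comp
    (contDiff_id.sub contDiff_const)

theorem contDiff_bary (p : Fin 4 → R3) (i : Fin 4) {n : WithTop ℕ∞} :
    ContDiff ℝ n (bary p i) := by
  have h : ∀ j, ContDiff ℝ n fun x => refMapInv p x j := contDiff_pi.1 (contDiff_refMapInv p)
  refine Fin.cases ?_ (fun j => ?_) i
  · exact contDiff_const.sub (ContDiff.sum fun j _ => h j)
  · exact h j

theorem contDiff_localNodal (p : Fin 4 → R3) (k : Fin 4 → ℕ) {n : WithTop ℕ∞} :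
    ContDiff ℝ n (localNodal p k) := by
  unfold localNodal
  have := fun i => contDiff_bary p i (n := n)
  fun_prop

theorem contDiff_bHat {n : WithTop ℕ∞} : ContDiff ℝ n bHat := by
  have h : ∀ j, ContDiff ℝ n fun x : R3 => x j := fun j => contDiff_apply ℝ ℝ j
  refine contDiff_pi.2 fun i => ?_
  fin_cases i
  · change ContDiff ℝ n fun x : R3 => bHat1 (x 0) (x 1) (x 2)
    unfold bHat1
    fun_prop
  · change ContDiff ℝ n fun x : R3 => bHat2 (x 0) (x 1) (x 2)
    unfold bHat2
    fun_prop
  · change ContDiff ℝ n fun x : R3 => bHat3 (x 0) (x 1) (x 2)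
    unfold bHat3
    fun_prop

theorem contDiff_piolaBubble (p : Fin 4 → R3) {n : WithTop ℕ∞} : ContDiff ℝ n (piolaBubble p) :=
  ((Matrix.mulVecLin (jac p)).toContinuousLinearMap.contDiff).comp
    (contDiff_bHat.comp (contDiff_refMapInv p))

end StokesP3

/-! ### Nodal functions on common faces and at Lagrange nodes -/

namespace StokesP3

open Finset

theorem mem_multiIdx {k : Fin 4 → ℕ} : k ∈ multiIdx ↔ ∑ i, k i = 3 :=
  Finset.Nat.mem_antidiagonalTuple

/-- Two affinely independent families that share some points can be matched by a permutation, in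
such a way that the barycentric coordinates agree on the convex hull of the common points and
those of unmatched points vanish there. -/
theorem exists_perm_bary_eq {p q : Fin 4 → R3} (hp : AffineIndependent ℝ p)
    (hq : AffineIndependent ℝ q) :
    ∃ e : Equiv.Perm (Fin 4),
      ∀ x ∈ convexHull ℝ (Set.range p ∩ Set.range q), ∀ i, bary p i x = bary q (e i) x ∧
        (p i = q (e i) ∨ bary p i x = 0) := by
  classical
  let f : {i // p i ∈ Set.range q} → {j // q j ∈ Set.range p} :=
    fun i => ⟨i.2.choose, i, i.2.choose_spec.symm⟩
  have hf : ∀ i, q (f i) = p i := fun i => i.2.choose_spec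
  have hbij : Function.Bijective f := by
    refine ⟨fun a b hab => Subtype.ext (hp.injective ?_), fun ⟨j, i, hij⟩ =>
      ⟨⟨i, j, hij.symm⟩, Subtype.ext (hq.injective ?_)⟩⟩
    · rw [← hf a, ← hf b, hab]
    · rw [hf]; exact hij
  -- The matching of common vertices is extended arbitrarily to the remaining ones; their
  -- coordinates vanish on the common face, so the choice is harmless.
  let e := (Equiv.ofBijective f hbij).extendSubtype
  have he : ∀ i, p i ∈ Set.range q → q (e i) = p i := fun i hi => by
    have := (Equiv.ofBijective f hbij).extendSubtype_apply_of_mem i hi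
    exact (congrArg q this).trans (hf ⟨i, hi⟩)
  have he' : ∀ i, p i ∉ Set.range q → q (e i) ∉ Set.range p := fun i hi =>
    (Equiv.ofBijective f hbij).extendSubtype_not_mem i hi
  -- Barycentric coordinates are affine, so identities between them on the convex hull need checking
  -- only at the common vertices.
  have hconv : ∀ (A : R3 →ᵃ[ℝ] ℝ), (∀ v ∈ Set.range p ∩ Set.range q, A v = 0) →
      ∀ x ∈ convexHull ℝ (Set.range p ∩ Set.range q), A x = 0 := fun A hA =>
    convexHull_min (t := A ⁻¹' {0}) hA ((convex_singleton (0 : ℝ)).affine_preimage A)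
  have hzero : ∀ (r : Fin 4 → R3) (hr : AffineIndependent ℝ r) (i : Fin 4),
      r i ∉ Set.range p ∩ Set.range q → Set.range p ∩ Set.range q ⊆ Set.range r →
      ∀ x ∈ convexHull ℝ (Set.range p ∩ Set.range q), bary r i x = 0 := by
    intro r hr i hi hsub x hx
    rw [bary_eq_coord hr]
    refine hconv _ (fun v hv => ?_) x hx
    obtain ⟨j, rfl⟩ := hsub hv
    rw [← bary_eq_coord hr, bary_vertex hr, if_neg]
    rintro rfl
    exact hi hv
  refine ⟨e, fun x hx i => ?_⟩
  by_cases hi : p i ∈ Set.range q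
  · refine ⟨?_, Or.inl (he i hi).symm⟩
    rw [bary_eq_coord hp, bary_eq_coord hq, ← sub_eq_zero]
    refine hconv ((vertexBasis p hp).coord i - (vertexBasis q hq).coord (e i)) ?_ x hx
    rintro _ ⟨⟨j, rfl⟩, hj⟩
    have hv : (vertexBasis q hq).coord (e i) (p j) = if i = j then 1 else 0 := by
      rw [← bary_eq_coord hq, ← he j hj, bary_vertex hq]
      simp
    change (vertexBasis p hp).coord i (p j) - (vertexBasis q hq).coord (e i) (p j) = 0
    rw [hv, ← bary_eq_coord hp, bary_vertex hp, sub_self]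
  · have h0 := hzero p hp i (fun h => hi h.2) Set.inter_subset_left x hx
    have h1 := hzero q hq (e i) (fun h => he' i hi h.1) Set.inter_subset_right x hx
    exact ⟨h0.trans h1.symm, Or.inr h0⟩

theorem localNodal_eq_zero_of_bary_eq_zero {p : Fin 4 → R3} {k : Fin 4 → ℕ} {x : R3} {i : Fin 4}
    (hk : k i ≠ 0) (hx : bary p i x = 0) : localNodal p k x = 0 := by
  refine Finset.prod_eq_zero (Finset.mem_univ i) (Finset.prod_eq_zero (i := 0) ?_ ?_)
  · simpa using Nat.pos_of_ne_zero hk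
  · simp [hx]

open Classical in
/-- The local contributions to a nodal function agree on the common part of two tetrahedra. -/
theorem sum_localNodal_eq {p q : Fin 4 → R3} (hp : AffineIndependent ℝ p)
    (hq : AffineIndependent ℝ q) {x : R3}
    (hx : x ∈ convexHull ℝ (Set.range p ∩ Set.range q)) (a : R3) :
    ∑ k ∈ multiIdx with localNode p k = a, localNodal p k x =
      ∑ k ∈ multiIdx with localNode q k = a, localNodal q k x := by
  obtain ⟨e, he⟩ := exists_perm_bary_eq hp hq
  rw [Finset.sum_filter, Finset.sum_filter]
  refine Finset.sum_equiv (e.arrowCongr (Equiv.refl ℕ)) (fun k => ?_) fun k _ => ?_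
  · rw [mem_multiIdx, mem_multiIdx, ← Equiv.sum_comp e fun i => e.arrowCongr (Equiv.refl ℕ) k i]
    simp
  · have hN : localNodal q (e.arrowCongr (Equiv.refl ℕ) k) x = localNodal p k x := by
      unfold localNodal
      rw [← Equiv.prod_comp e]
      refine Finset.prod_congr rfl fun i _ => ?_
      simp [(he x hx i).1]
    rw [hN]
    -- If the value at `x` is nonzero, then `k` is supported on matched vertices and both tetrahedra
    -- give the same node. Otherwise the two nodes may differ, but the term is zero on both sides.
    by_cases h0 : localNodal p k x = 0
    · simp [h0]
    · have : localNode q (e.arrowCongr (Equiv.refl ℕ) k) = localNode p k := by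
        unfold localNode
        rw [← Equiv.sum_comp e]
        refine Finset.sum_congr rfl fun i _ => ?_
        rcases (he x hx i).2 with h | h
        · simp [h]
        · have : k i = 0 := by
            by_contra hk
            exact h0 (localNodal_eq_zero_of_bary_eq_zero hk h)
          simp [this]
      rw [this]

theorem bary_localNode {p : Fin 4 → R3} (hp : AffineIndependent ℝ p) {k : Fin 4 → ℕ}
    (hk : k ∈ multiIdx) (i : Fin 4) : bary p i (localNode p k) = (k i : ℝ) / 3 := by
  refine bary_eq_of_sum hp (w := fun i => (k i : ℝ) / 3) ?_ i
  rw [← Finset.sum_div]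
  have : (∑ i, (k i : ℝ)) = 3 := by exact_mod_cast mem_multiIdx.1 hk
  rw [this]; norm_num

/-- For `l = k` each inner product is `k_i! / k_i!`. For `l ≠ k` the equal sums force `k i < l i`
for some `i`, and the factor with `m = k i` vanishes. -/
theorem localNodal_localNode {p : Fin 4 → R3} (hp : AffineIndependent ℝ p) {k l : Fin 4 → ℕ}
    (hk : k ∈ multiIdx) (hl : l ∈ multiIdx) :
    localNodal p l (localNode p k) = if l = k then 1 else 0 := by
  unfold localNodal
  simp only [bary_localNode hp hk]
  split_ifs with h
  · subst h
    refine Finset.prod_eq_one fun i _ => ?_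
    rw [Finset.prod_div_distrib, ← Finset.prod_range_reflect, div_eq_one_iff_eq]
    · refine Finset.prod_congr rfl fun m hm => ?_
      have := Finset.mem_range.1 hm
      rw [Nat.sub_sub, Nat.cast_sub (by omega)]
      push_cast
      ring
    · exact Finset.prod_ne_zero_iff.2 fun m _ => by positivity
  · obtain ⟨i, hi⟩ : ∃ i, k i < l i := by
      by_contra! hle
      refine h (funext fun i => ?_)
      have hs : ∑ i, l i = ∑ i, k i := (mem_multiIdx.1 hl).trans (mem_multiIdx.1 hk).symm
      exact (Finset.sum_eq_sum_iff_of_le fun i _ => hle i).1 hs i (Finset.mem_univ i)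
    refine Finset.prod_eq_zero (Finset.mem_univ i)
      (Finset.prod_eq_zero (Finset.mem_range.2 hi) ?_)
    rw [mul_div_cancel₀ _ (by norm_num : (3 : ℝ) ≠ 0), sub_self, zero_div]

/-! ### The discrete field on a single tetrahedron of the grid -/

namespace TetMesh

variable {n : ℕ} (M : TetMesh n)

theorem mem_tet_iff {t : Fin n} {x : R3} : x ∈ M.tet t ↔ ∀ i, 0 ≤ bary (M.vert t) i x :=
  mem_convexHull_iff_bary (M.affineIndependent t)

theorem mem_interior_tet_iff {t : Fin n} {x : R3} :
    x ∈ interior (M.tet t) ↔ ∀ i, 0 < bary (M.vert t) i x :=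
  mem_interior_convexHull_iff_bary (M.affineIndependent t)

theorem isCompact_tet (t : Fin n) : IsCompact (M.tet t) :=
  (Set.finite_range (M.vert t)).isCompact_convexHull ℝ

theorem convex_tet (t : Fin n) : Convex ℝ (M.tet t) := convex_convexHull ℝ _

theorem closure_interior_tet (t : Fin n) : closure (interior (M.tet t)) = M.tet t := by
  rw [(M.convex_tet t).closure_interior_eq_closure_of_nonempty_interior (𝕜 := ℝ),
    (M.isCompact_tet t).isClosed.closure_eq]
  exact ⟨_, (vertexBasis _ (M.affineIndependent t)).centroid_mem_interior_convexHull⟩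

open Classical in
theorem nodal_eq {t : Fin n} {x : R3} (hx : x ∈ M.tet t) (a : R3) :
    M.nodal a x = ∑ k ∈ multiIdx with localNode (M.vert t) k = a, localNodal (M.vert t) k x := by
  have h : ∃ t, x ∈ M.tet t := ⟨t, hx⟩
  rw [nodal, dif_pos h]
  refine sum_localNodal_eq (M.affineIndependent _) (M.affineIndependent _) ?_ a
  rw [← M.conforming]
  exact ⟨h.choose_spec, hx⟩

theorem localNode_mem_nodes (t : Fin n) {k : Fin 4 → ℕ} (hk : k ∈ multiIdx) :
    localNode (M.vert t) k ∈ M.nodes :=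
  Finset.mem_biUnion.2 ⟨t, Finset.mem_univ t, Finset.mem_image_of_mem _ hk⟩

/-- The cubic vector polynomial on the tetrahedron `t` with nodal values `c`. -/
noncomputable def localConforming (c : M.nodes → Fin 3 → ℝ) (t : Fin n) (x : R3) : R3 :=
  ∑ k : multiIdx, localNodal (M.vert t) k x • c ⟨_, M.localNode_mem_nodes t k.2⟩

theorem conformingPart_eq (c : M.nodes → Fin 3 → ℝ) {t : Fin n} {x : R3} (hx : x ∈ M.tet t) :
    M.conformingPart c x = M.localConforming c t x := by
  classical
  have h1 : M.conformingPart c x = ∑ a : M.nodes, M.nodal a x • c a := by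
    ext m
    simp [conformingPart, Finset.sum_apply, Pi.single_apply, mul_comm]
  rw [h1, localConforming]
  have h2 : ∀ a : M.nodes, M.nodal a x • c a = ∑ k : multiIdx,
      if (⟨_, M.localNode_mem_nodes t k.2⟩ : M.nodes) = a
        then localNodal (M.vert t) k x • c a else 0 := fun a => by
    rw [M.nodal_eq hx, Finset.sum_filter, Finset.sum_smul, ← Finset.sum_coe_sort multiIdx]
    refine Finset.sum_congr rfl fun k _ => ?_
    simp only [Subtype.ext_iff, ite_smul, zero_smul]
  simp only [h2]
  rw [Finset.sum_comm]
  refine Finset.sum_congr rfl fun k _ => ?_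
  simp

theorem localNode_mem_tet (t : Fin n) {k : Fin 4 → ℕ} (hk : k ∈ multiIdx) :
    localNode (M.vert t) k ∈ M.tet t := by
  rw [mem_tet_iff]
  intro i
  rw [bary_localNode (M.affineIndependent t) hk]
  positivity

/-- The Kronecker property of the local basis makes the coefficients recoverable from the function,
so a vanishing `v_c` has `c = 0`. -/
theorem conformingPart_node (c : M.nodes → Fin 3 → ℝ) (a : M.nodes) :
    M.conformingPart c a = c a := by
  obtain ⟨t, -, hk⟩ := Finset.mem_biUnion.1 a.2
  obtain ⟨k, hk, hka⟩ := Finset.mem_image.1 hk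
  have hx : (a : R3) ∈ M.tet t := hka ▸ M.localNode_mem_tet t hk
  have hval : ∀ l : multiIdx, localNodal (M.vert t) l a = if (l : Fin 4 → ℕ) = k then 1 else 0 :=
    fun l => by rw [← hka, localNodal_localNode (M.affineIndependent t) hk l.2]
  rw [M.conformingPart_eq c hx]
  unfold localConforming
  rw [Finset.sum_eq_single_of_mem ⟨k, hk⟩ (Finset.mem_univ _)]
  · rw [hval, if_pos rfl, one_smul]
    exact congrArg c (Subtype.ext hka)
  · intro l _ hne
    rw [hval, if_neg (fun h => hne (Subtype.ext h)), zero_smul]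

theorem contDiff_localConforming (c : M.nodes → Fin 3 → ℝ) (t : Fin n) {r : WithTop ℕ∞} :
    ContDiff ℝ r (M.localConforming c t) :=
  ContDiff.sum fun _ _ => (contDiff_localNodal _ _).smul contDiff_const

theorem notMem_tet_of_mem_interior {s t : Fin n} (hst : s ≠ t) {x : R3}
    (hx : x ∈ interior (M.tet t)) : x ∉ M.tet s := by
  intro hs
  have hmem : x ∈ convexHull ℝ (Set.range (M.vert t) ∩ Set.range (M.vert s)) := by
    rw [← M.conforming]
    exact ⟨interior_subset hx, hs⟩
  obtain ⟨e, he⟩ := exists_perm_bary_eq (M.affineIndependent t) (M.affineIndependent s)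
  -- At an interior point all coordinates are positive, so every vertex is a common one, and the two
  -- tetrahedra would have the same vertex set.
  have h : ∀ i, M.vert t i = M.vert s (e i) := fun i =>
    (he x hmem i).2.resolve_right ((M.mem_interior_tet_iff.1 hx i).ne')
  refine hst (M.distinct ?_)
  have : M.vert t = M.vert s ∘ e := funext h
  change Set.range (M.vert s) = Set.range (M.vert t)
  rw [this, e.surjective.range_comp]

/-- The smooth function that represents `v_c + v_b` on the tetrahedron `t`. -/
noncomputable def localField (c : M.nodes → Fin 3 → ℝ) (d : Fin n → Fin 9 → ℝ) (t : Fin n)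
    (x : R3) : R3 :=
  M.localConforming c t x + ∑ i, d t i • piolaBubble (M.vert t ∘ numbering i) x

theorem contDiff_localField (c : M.nodes → Fin 3 → ℝ) (d : Fin n → Fin 9 → ℝ) (t : Fin n)
    {r : WithTop ℕ∞} : ContDiff ℝ r (M.localField c d t) :=
  (M.contDiff_localConforming c t).add
    (ContDiff.sum fun _ _ => (contDiff_piolaBubble _).const_smul _)

/-- Only the interior is possible in general: on a shared face the bubbles of the neighbouring
tetrahedron are added as well. -/
theorem eqOn_localField (c : M.nodes → Fin 3 → ℝ) (d : Fin n → Fin 9 → ℝ) (t : Fin n) :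
    Set.EqOn (M.conformingPart c + M.bubblePart d) (M.localField c d t) (interior (M.tet t)) := by
  intro x hx
  rw [Pi.add_apply, M.conformingPart_eq c (interior_subset hx), localField, bubblePart,
    Finset.sum_apply, Finset.sum_eq_single t]
  · simp [bubble, Set.indicator_of_mem (interior_subset hx)]
  · intro s _ hs
    simp [bubble, Set.indicator_of_notMem (M.notMem_tet_of_mem_interior hs hx)]
  · simp

end TetMesh

end StokesP3

/-! ### The energy form, and the kernel on conforming functions -/

namespace StokesP3

open MeasureTheory

/-- The Frobenius product `∇u : ∇v` at a point. -/
noncomputable def gradDot (u v : R3 → R3) (x : R3) : ℝ :=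
  ∑ m : Fin 3, ∑ r : Fin 3,
    fderiv ℝ u x (Pi.single r 1) m * fderiv ℝ v x (Pi.single r 1) m

theorem gradDot_comm (u v : R3 → R3) (x : R3) : gradDot u v x = gradDot v u x := by
  simp only [gradDot, mul_comm]

theorem gradDot_self_nonneg (u : R3 → R3) (x : R3) : 0 ≤ gradDot u u x :=
  Finset.sum_nonneg fun _ _ => Finset.sum_nonneg fun _ _ => mul_self_nonneg _

theorem fderiv_eq_zero_of_gradDot_self {u : R3 → R3} {x : R3} (h : gradDot u u x = 0) :
    fderiv ℝ u x = 0 := by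
  have h1 : ∀ m r, fderiv ℝ u x (Pi.single r 1) m = 0 := by
    intro m r
    have h2 := (Finset.sum_eq_zero_iff_of_nonneg fun m _ =>
      Finset.sum_nonneg fun r _ => mul_self_nonneg (fderiv ℝ u x (Pi.single r 1) m)).1 h m
      (Finset.mem_univ m)
    exact mul_self_eq_zero.1 <| (Finset.sum_eq_zero_iff_of_nonneg fun r _ =>
      mul_self_nonneg (fderiv ℝ u x (Pi.single r 1) m)).1 h2 r (Finset.mem_univ r)
  refine ContinuousLinearMap.coe_injective ((Pi.basisFun ℝ (Fin 3)).ext fun r => ?_)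
  ext m
  simpa using h1 m r

theorem continuous_gradDot {u v : R3 → R3} (hu : ContDiff ℝ 1 u) (hv : ContDiff ℝ 1 v) :
    Continuous (gradDot u v) := by
  have h : ∀ {w : R3 → R3}, ContDiff ℝ 1 w → ∀ r m, Continuous fun x =>
      fderiv ℝ w x (Pi.single r 1) m := fun hw r m =>
    (continuous_apply m).comp ((hw.continuous_fderiv one_ne_zero).clm_apply continuous_const)
  exact continuous_finsetSum _ fun m _ => continuous_finsetSum _ fun r _ =>
    (h hu r m).mul (h hv r m)

namespace TetMesh

variable {n : ℕ} (M : TetMesh n)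

/-- On the interior of each tetrahedron the function agrees with a `C¹` function on `R3`. -/
def IsPiecewiseC1 (u : R3 → R3) : Prop :=
  ∀ t, ∃ g : R3 → R3, ContDiff ℝ 1 g ∧ Set.EqOn u g (interior (M.tet t))

theorem gradForm_eq (u v : R3 → R3) :
    M.gradForm u v = ∑ t, ∫ x in interior (M.tet t), gradDot u v x := rfl

theorem gradForm_comm (u v : R3 → R3) : M.gradForm u v = M.gradForm v u := by
  simp only [gradForm_eq, gradDot_comm u v]

theorem gradForm_self_nonneg (u : R3 → R3) : 0 ≤ M.gradForm u u :=
  Finset.sum_nonneg fun _ _ => integral_nonneg fun x => gradDot_self_nonneg u x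

variable {M}

theorem fderiv_eqOn_of_eqOn_interior {u g : R3 → R3} {t : Fin n}
    (h : Set.EqOn u g (interior (M.tet t))) :
    Set.EqOn (fderiv ℝ u) (fderiv ℝ g) (interior (M.tet t)) := fun _ hx =>
  (h.eventuallyEq_of_mem (isOpen_interior.mem_nhds hx)).fderiv_eq

theorem IsPiecewiseC1.differentiableAt {u : R3 → R3} (hu : M.IsPiecewiseC1 u) {t : Fin n}
    {x : R3} (hx : x ∈ interior (M.tet t)) : DifferentiableAt ℝ u x := by
  obtain ⟨g, hg, hug⟩ := hu t
  exact (hg.differentiable one_ne_zero x).congr_of_eventuallyEq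
    (hug.eventuallyEq_of_mem (isOpen_interior.mem_nhds hx))

theorem IsPiecewiseC1.continuousOn_gradDot {u v : R3 → R3} (hu : M.IsPiecewiseC1 u)
    (hv : M.IsPiecewiseC1 v) (t : Fin n) : ContinuousOn (gradDot u v) (interior (M.tet t)) := by
  obtain ⟨f, hf, huf⟩ := hu t
  obtain ⟨g, hg, hvg⟩ := hv t
  refine (continuous_gradDot hf hg).continuousOn.congr fun x hx => ?_
  simp only [gradDot, fderiv_eqOn_of_eqOn_interior huf hx, fderiv_eqOn_of_eqOn_interior hvg hx]

theorem IsPiecewiseC1.integrableOn_gradDot {u v : R3 → R3} (hu : M.IsPiecewiseC1 u)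
    (hv : M.IsPiecewiseC1 v) (t : Fin n) : IntegrableOn (gradDot u v) (interior (M.tet t)) := by
  obtain ⟨f, hf, huf⟩ := hu t
  obtain ⟨g, hg, hvg⟩ := hv t
  have h := ((continuous_gradDot hf hg).continuousOn.integrableOn_compact
    (M.isCompact_tet t) (μ := volume)).mono_set interior_subset
  refine h.congr_fun (fun x hx => ?_) isOpen_interior.measurableSet
  simp only [gradDot, fderiv_eqOn_of_eqOn_interior huf hx, fderiv_eqOn_of_eqOn_interior hvg hx]

theorem IsPiecewiseC1.gradForm_add_left {u v w : R3 → R3} (hu : M.IsPiecewiseC1 u)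
    (hv : M.IsPiecewiseC1 v) (hw : M.IsPiecewiseC1 w) :
    M.gradForm (u + v) w = M.gradForm u w + M.gradForm v w := by
  simp only [gradForm_eq, ← Finset.sum_add_distrib]
  refine Finset.sum_congr rfl fun t _ => ?_
  rw [← integral_add (hu.integrableOn_gradDot hw t) (hv.integrableOn_gradDot hw t)]
  refine setIntegral_congr_fun isOpen_interior.measurableSet fun x hx => ?_
  simp only [gradDot, fderiv_add (hu.differentiableAt hx) (hv.differentiableAt hx),
    add_apply, Pi.add_apply, add_mul, Finset.sum_add_distrib]

theorem IsPiecewiseC1.gradForm_smul_left {u : R3 → R3} (hu : M.IsPiecewiseC1 u) (r : ℝ)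
    (w : R3 → R3) : M.gradForm (r • u) w = r * M.gradForm u w := by
  simp only [gradForm_eq, Finset.mul_sum]
  refine Finset.sum_congr rfl fun t _ => ?_
  rw [← integral_const_mul]
  refine setIntegral_congr_fun isOpen_interior.measurableSet fun x hx => ?_
  simp only [gradDot, fderiv_const_smul (hu.differentiableAt hx),
    smul_apply, Pi.smul_apply, smul_eq_mul, mul_assoc, Finset.mul_sum]

/-- A piecewise `C¹` function of zero energy is constant on the interior of each tetrahedron. -/
theorem IsPiecewiseC1.exists_eq_const_of_gradForm_self {u : R3 → R3} (hu : M.IsPiecewiseC1 u)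
    (h : M.gradForm u u = 0) (t : Fin n) : ∃ w, ∀ x ∈ interior (M.tet t), u x = w := by
  have h1 : ∫ x in interior (M.tet t), gradDot u u x = 0 :=
    (Finset.sum_eq_zero_iff_of_nonneg fun t _ =>
      integral_nonneg fun x => gradDot_self_nonneg u x).1 h t (Finset.mem_univ t)
  rw [integral_eq_zero_iff_of_nonneg (fun x => gradDot_self_nonneg u x)
    (hu.integrableOn_gradDot hu t)] at h1
  -- The integrand is continuous on an open set, so vanishing almost everywhere becomes vanishing
  -- everywhere.
  have h2 := Measure.eqOn_open_of_ae_eq h1 isOpen_interior (hu.continuousOn_gradDot hu t)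
    continuousOn_const
  exact isOpen_interior.exists_is_const_of_fderiv_eq_zero
    (M.convex_tet t).interior.isPreconnected
    (fun x hx => (hu.differentiableAt hx).differentiableWithinAt)
    (fun x hx => fderiv_eq_zero_of_gradDot_self (h2 hx))

variable (M) in
theorem isPiecewiseC1_add (c : M.nodes → Fin 3 → ℝ) (d : Fin n → Fin 9 → ℝ) :
    M.IsPiecewiseC1 (M.conformingPart c + M.bubblePart d) := fun t =>
  ⟨_, M.contDiff_localField c d t, M.eqOn_localField c d t⟩

variable (M) in
/-- A function that is constant on each tetrahedron and vanishes
on the boundary is zero. -/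
theorem eq_zero_of_const_on_tet {u : R3 → R3} (hbd : ∀ x ∈ frontier M.domain, u x = 0)
    (hc : ∀ t, ∃ w, ∀ x ∈ M.tet t, u x = w) (t : Fin n) : ∀ x ∈ M.tet t, u x = 0 := by
  choose w hw using hc
  intro x hx
  by_contra hne
  set U : Set R3 := ⋃ t, M.tet t with hU
  have hcl : ∀ I : Set (Fin n), IsClosed (⋃ s ∈ I, M.tet s) := fun I =>
    I.toFinite.isClosed_biUnion fun s _ => (M.isCompact_tet s).isClosed
  -- `S` collects the tetrahedra with the nonzero value `u x`, and `R` the others. Connectedness of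
  -- the domain is not required: `S` itself is shown to be clopen in the whole space.
  set S : Set R3 := ⋃ s ∈ {s | w s = u x}, M.tet s with hS
  set R : Set R3 := ⋃ s ∈ {s | w s ≠ u x}, M.tet s with hR
  have hUc : IsClosed U := isClosed_iUnion_of_finite fun s => (M.isCompact_tet s).isClosed
  have hUd : U ⊆ closure M.domain := Set.iUnion_subset fun s => by
    rw [← M.closure_interior_tet s]
    exact closure_mono (interior_mono (Set.subset_iUnion M.tet s))
  have hSu : ∀ y ∈ S, u y = u x := by
    intro y hy
    obtain ⟨s, hs, hys⟩ := Set.mem_iUnion₂.1 hy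
    exact (hw s y hys).trans hs
  have hSU : S ⊆ U := Set.iUnion₂_subset fun s _ => Set.subset_iUnion M.tet s
  -- A point of the grid outside the open domain lies on the boundary, where `u` is zero and so
  -- differs from `u x`.
  have hSd : S ⊆ M.domain := fun y hy => by
    by_contra hyd
    have : y ∈ frontier M.domain := ⟨hUd (hSU hy), by rwa [domain, interior_interior]⟩
    exact hne ((hSu y hy).symm.trans (hbd y this))
  have hSeq : S = M.domain ∩ Rᶜ := by
    ext y
    refine ⟨fun hy => ⟨hSd hy, fun hyR => ?_⟩, fun hy => ?_⟩
    · obtain ⟨s, hs, hys⟩ := Set.mem_iUnion₂.1 hyR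
      exact hs ((hw s y hys).symm.trans (hSu y hy))
    · obtain ⟨s, hys⟩ := Set.mem_iUnion.1 (interior_subset hy.1)
      by_cases hs : w s = u x
      · exact Set.mem_iUnion₂.2 ⟨s, hs, hys⟩
      · exact absurd (Set.mem_iUnion₂.2 ⟨s, hs, hys⟩) hy.2
  have hclopen : IsClopen S := ⟨hcl _, by
    rw [hSeq]
    exact isOpen_interior.inter (hcl _).isOpen_compl⟩
  have hSuniv : S = Set.univ := hclopen.eq_univ
    ⟨x, Set.mem_iUnion₂.2 ⟨t, (hw t x hx).symm, hx⟩⟩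
  have hcomp : IsCompact S :=
    (Set.toFinite {s | w s = u x}).isCompact_biUnion fun s _ => M.isCompact_tet s
  rw [hSuniv] at hcomp
  exact noncompact_univ R3 hcomp

theorem eq_zero_of_conformingPart_const {c : M.nodes → Fin 3 → ℝ} (hc : M.Admissible c)
    (h : ∀ t, ∃ w, ∀ x ∈ interior (M.tet t), M.conformingPart c x = w) : c = 0 := by
  have h1 : ∀ t, ∃ w, ∀ x ∈ M.tet t, M.conformingPart c x = w := fun t => by
    obtain ⟨w, hw⟩ := h t
    refine ⟨w, fun x hx => ?_⟩
    have hcont : Continuous (M.localConforming c t) :=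
      (M.contDiff_localConforming c t (r := 0)).continuous
    rw [M.conformingPart_eq c hx]
    -- The local polynomial is continuous, so its constancy passes from the interior to the closed
    -- tetrahedron.
    have hsub : closure (interior (M.tet t)) ⊆ {x | M.localConforming c t x = w} :=
      closure_minimal (fun y hy => (M.conformingPart_eq c (interior_subset hy)).symm.trans
        (hw y hy)) (isClosed_eq hcont continuous_const)
    rw [M.closure_interior_tet] at hsub
    exact hsub hx
  funext a
  obtain ⟨t, -, hk⟩ := Finset.mem_biUnion.1 a.2
  obtain ⟨k, hk, hka⟩ := Finset.mem_image.1 hk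
  rw [← M.conformingPart_node c a]
  exact M.eq_zero_of_const_on_tet hc h1 t a (hka ▸ M.localNode_mem_tet t hk)

end TetMesh

end StokesP3

/-! ### Fourth differences along lines -/

namespace StokesP3

open Finset

/-- The fourth forward difference at `0` of a function of one real variable. -/
noncomputable def fourthDiff {E : Type*} [AddCommGroup E] [Module ℝ E] (f : ℝ → E) : E :=
  f 0 - (4 : ℝ) • f 1 + (6 : ℝ) • f 2 - (4 : ℝ) • f 3 + f 4

theorem fourthDiff_eq_zero_of_polynomial {f : ℝ → ℝ} (P : Polynomial ℝ) (hP : P.natDegree < 4)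
    (hf : ∀ t, f t = P.eval t) : fourthDiff f = 0 := by
  have h := congrFun (Polynomial.fwdDiff_iter_eq_zero_of_degree_lt hP) 0
  rw [fwdDiff_iter_eq_sum_shift] at h
  simp only [Finset.sum_range_succ, Finset.sum_range_zero, Nat.choose] at h
  simp only [fourthDiff, hf, smul_eq_mul]
  norm_num at h ⊢
  linarith

theorem fourthDiff_sum {E ι : Type*} [AddCommGroup E] [Module ℝ E] (s : Finset ι)
    (f : ι → ℝ → E) : fourthDiff (fun t => ∑ i ∈ s, f i t) = ∑ i ∈ s, fourthDiff (f i) := by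
  simp only [fourthDiff, Finset.smul_sum, Finset.sum_add_distrib, Finset.sum_sub_distrib]

theorem fourthDiff_add {E : Type*} [AddCommGroup E] [Module ℝ E] (f g : ℝ → E) :
    fourthDiff (fun t => f t + g t) = fourthDiff f + fourthDiff g := by
  simp only [fourthDiff, smul_add]
  abel

theorem fourthDiff_smul_const {E : Type*} [AddCommGroup E] [Module ℝ E] (f : ℝ → ℝ) (c : E) :
    fourthDiff (fun t => f t • c) = fourthDiff f • c := by
  simp only [fourthDiff, smul_eq_mul, add_smul, sub_smul, mul_smul]

theorem fourthDiff_map {E F : Type*} [AddCommGroup E] [Module ℝ E] [AddCommGroup F] [Module ℝ F]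
    (A : E →ₗ[ℝ] F) (f : ℝ → E) : fourthDiff (fun t => A (f t)) = A (fourthDiff f) := by
  simp only [fourthDiff, map_add, map_sub, map_smul]

theorem fourthDiff_eq_zero_of_const {E : Type*} [AddCommGroup E] [Module ℝ E] {f : ℝ → E} {c : E}
    (h : ∀ t, 0 ≤ t → t ≤ 4 → f t = c) : fourthDiff f = 0 := by
  rw [fourthDiff, h 0 (by norm_num) (by norm_num), h 1 (by norm_num) (by norm_num),
    h 2 (by norm_num) (by norm_num), h 3 (by norm_num) (by norm_num),
    h 4 (by norm_num) (by norm_num)]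
  module

/-- The quartic part of the reference bubble. -/
noncomputable def bTop (x : R3) : R3 :=
  ![263 / 12 * x 0 ^ 4 + 38 * x 0 ^ 3 * x 1 + 265 / 3 * x 0 ^ 3 * x 2 + 29 * x 0 ^ 2 * x 1 ^ 2 +
      96 * x 0 ^ 2 * x 1 * x 2 + 209 / 2 * x 0 ^ 2 * x 2 ^ 2 - 16 * x 0 * x 1 ^ 3 +
      42 * x 0 * x 1 ^ 2 * x 2 + 42 * x 0 * x 1 * x 2 ^ 2 + 103 / 3 * x 0 * x 2 ^ 3 +
      7 / 6 * x 1 ^ 4 - x 1 ^ 2 * x 2 ^ 2 - 335 / 12 * x 2 ^ 4,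
    -233 / 3 * x 0 ^ 3 * x 1 + 67 / 9 * x 0 ^ 3 * x 2 - 233 / 2 * x 0 ^ 2 * x 1 ^ 2 -
      235 * x 0 ^ 2 * x 1 * x 2 + 163 / 6 * x 0 ^ 2 * x 2 ^ 2 - 203 / 3 * x 0 * x 1 ^ 3 -
      225 * x 0 * x 1 ^ 2 * x 2 - 209 * x 0 * x 1 * x 2 ^ 2 + 301 / 9 * x 0 * x 2 ^ 3 -
      64 / 3 * x 1 ^ 3 * x 2 - 21 * x 1 ^ 2 * x 2 ^ 2 - 16 / 3 * x 1 * x 2 ^ 3,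
    -10 * x 0 ^ 3 * x 1 - 10 * x 0 ^ 3 * x 2 + x 0 ^ 2 * x 1 ^ 2 + 119 * x 0 ^ 2 * x 1 * x 2 -
      15 * x 0 ^ 2 * x 2 ^ 2 + 16 * x 0 * x 1 ^ 3 + 145 * x 0 * x 1 ^ 2 * x 2 +
      129 * x 0 * x 1 * x 2 ^ 2 + 16 * x 1 ^ 3 * x 2 + 11 * x 1 ^ 2 * x 2 ^ 2 -
      29 / 4 * x 2 ^ 4]

/-- Along a line the bubble is a quartic in `t` with leading coefficient `bTop w`. The fourth
difference kills the lower powers and multiplies `t ^ 4` by `4! = 24`, so the base point `y` drops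
out. -/
theorem fourthDiff_bHat (y w : R3) :
    fourthDiff (fun t => bHat (y + t • w)) = (24 : ℝ) • bTop w := by
  ext m
  have h : ∀ t j, (y + t • w) j = y j + t * w j := fun _ _ => rfl
  fin_cases m
  · change fourthDiff (fun t => bHat1 ((y + t • w) 0) ((y + t • w) 1) ((y + t • w) 2)) = 24 * _
    simp only [h, fourthDiff, bHat1, smul_eq_mul, bTop, Fin.zero_eta, Matrix.cons_val_zero]
    ring
  · change fourthDiff (fun t => bHat2 ((y + t • w) 0) ((y + t • w) 1) ((y + t • w) 2)) = 24 * _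
    simp only [h, fourthDiff, bHat2, smul_eq_mul, bTop, Fin.mk_one, Matrix.cons_val_one,
      Matrix.cons_val_zero]
    ring
  · change fourthDiff (fun t => bHat3 ((y + t • w) 0) ((y + t • w) 1) ((y + t • w) 2)) = 24 * _
    simp only [h, fourthDiff, bHat3, smul_eq_mul, bTop, Fin.reduceFinMk, Matrix.cons_val]
    ring

/-- The vertices of the reference tetrahedron. -/
noncomputable def refVertex (i : Fin 4) (l : Fin 3) : ℝ := if i = l.succ then 1 else 0

/-- The increments of the barycentric coordinates along the reference direction `w`. -/
noncomputable def baryDir (w : R3) : Fin 4 → ℝ := Fin.cons (-∑ j, w j) w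

/-- Renumbering the vertices amounts to composing with an affine map of reference space. The common
factor `jac p` can then be cancelled, leaving equations independent of the tetrahedron. -/
theorem jac_comp (p : Fin 4 → R3) (σ : Fin 4 → Fin 4) :
    jac (p ∘ σ) = jac p * jac (refVertex ∘ σ) := by
  have h : ∀ i r, ∑ l : Fin 3, (p l.succ r - p 0 r) * refVertex i l = p i r - p 0 r := by
    intro i r
    refine Fin.cases ?_ (fun i => ?_) i
    · simp [refVertex, (Fin.succ_ne_zero _).symm]
    · simp [refVertex]
  ext r j
  simp only [jac, Matrix.mul_apply, Matrix.of_apply, Function.comp_apply, mul_sub,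
    Finset.sum_sub_distrib, h]
  ring

theorem piolaBubble_comp {p : Fin 4 → R3} (hp : AffineIndependent ℝ p)
    (σ : Equiv.Perm (Fin 4)) (x : R3) :
    piolaBubble (p ∘ σ) x = (jac p).mulVec ((jac (refVertex ∘ σ)).mulVec
      (bHat fun j => bary p (σ j.succ) x)) := by
  have h : refMapInv (p ∘ σ) x = fun j => bary p (σ j.succ) x := funext fun j =>
    bary_comp_equiv hp σ j.succ x
  rw [piolaBubble, h, jac_comp, Matrix.mulVec_mulVec]

theorem bary_refMap_line {p : Fin 4 → R3} (hp : AffineIndependent ℝ p) (w : R3) (t : ℝ)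
    (i : Fin 4) : bary p i (refMap p ((fun _ => 1 / 4) + t • w)) = 1 / 4 + t * baryDir w i := by
  rw [bary_refMap hp]
  refine Fin.cases ?_ (fun j => ?_) i
  · simp only [Fin.cons_zero, baryDir, Fin.sum_univ_three, Pi.add_apply, Pi.smul_apply,
      smul_eq_mul]
    ring
  · rfl

theorem fourthDiff_localNodal {p : Fin 4 → R3} (hp : AffineIndependent ℝ p) {k : Fin 4 → ℕ}
    (hk : k ∈ multiIdx) (w : R3) :
    fourthDiff (fun t => localNodal p k (refMap p ((fun _ => 1 / 4) + t • w))) = 0 := by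
  -- Along the line the nodal function is a product of `k 0 + k 1 + k 2 + k 3 = 3` factors of degree
  -- at most one in `t`.
  let P : Polynomial ℝ := ∏ i, ∏ m ∈ Finset.range (k i),
    (Polynomial.C (3 * baryDir w i / (m + 1)) * Polynomial.X +
      Polynomial.C ((3 / 4 - m) / (m + 1) : ℝ))
  refine fourthDiff_eq_zero_of_polynomial P ?_ fun t => ?_
  · have h1 : P.natDegree ≤ ∑ i, k i := by
      refine (Polynomial.natDegree_prod_le _ _).trans (Finset.sum_le_sum fun i _ => ?_)
      refine (Polynomial.natDegree_prod_le _ _).trans ?_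
      refine (Finset.sum_le_sum fun m _ => Polynomial.natDegree_linear_le).trans ?_
      simp
    rw [mem_multiIdx.1 hk] at h1
    omega
  · simp only [localNodal, bary_refMap_line hp, P, Polynomial.eval_prod, Polynomial.eval_add,
      Polynomial.eval_mul, Polynomial.eval_C, Polynomial.eval_X]
    refine Finset.prod_congr rfl fun i _ => Finset.prod_congr rfl fun m _ => ?_
    ring

theorem numbering_injective (i : Fin 9) : Function.Injective (numbering i) := by
  revert i
  decide

theorem fourthDiff_piolaBubble {p : Fin 4 → R3} (hp : AffineIndependent ℝ p)
    (σ : Equiv.Perm (Fin 4)) (w : R3) :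
    fourthDiff (fun t => piolaBubble (p ∘ σ) (refMap p ((fun _ => 1 / 4) + t • w))) =
      (24 : ℝ) • (jac p).mulVec ((jac (refVertex ∘ σ)).mulVec
        (bTop fun j => baryDir w (σ j.succ))) := by
  have h := fourthDiff_map ((jac p).mulVecLin ∘ₗ (jac (refVertex ∘ σ)).mulVecLin)
    fun t => bHat ((fun _ => 1 / 4) + t • fun j => baryDir w (σ j.succ))
  rw [fourthDiff_bHat, map_smul] at h
  simp only [piolaBubble_comp hp, bary_refMap_line hp]
  exact h

end StokesP3

/-! ### Linear independence of the quartic parts -/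

namespace StokesP3

theorem refVertex_eq : refVertex = ![![0, 0, 0], ![1, 0, 0], ![0, 1, 0], ![0, 0, 1]] := by
  ext i l
  fin_cases i <;> fin_cases l <;> simp [refVertex, Fin.ext_iff]

theorem jac_mulVec_apply (p : Fin 4 → R3) (u : R3) (m : Fin 3) :
    (jac p).mulVec u m =
      (p 1 m - p 0 m) * u 0 + (p 2 m - p 0 m) * u 1 + (p 3 m - p 0 m) * u 2 := by
  simp only [jac, Matrix.mulVec, dotProduct, Fin.sum_univ_three, Matrix.of_apply]
  rfl

theorem baryDir_eq (w : R3) : baryDir w = ![-(w 0 + w 1 + w 2), w 0, w 1, w 2] := by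
  ext i
  fin_cases i
  · simp [baryDir, Fin.sum_univ_three]
  all_goals rfl

/-- The quartic part, in the reference direction `w`, of a combination of bubbles. -/
noncomputable def bubbleTop (d : Fin 9 → ℝ) (w : R3) : R3 :=
  ∑ i, d i • (jac (refVertex ∘ numbering i)).mulVec
    (bTop fun j => baryDir w (numbering i j.succ))

/-- This direction and the next two are parallel to the edges from the vertex `e₁` to `0`, `e₃` and
`e₂`. As `bTop` is homogeneous of degree four, the common factor `20⁻⁴` cancels. -/
theorem bubbleTop_x {d : Fin 9 → ℝ} (h : bubbleTop d ![-1 / 20, 0, 0] = 0) :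
    263 / 12 * d 0 - 29 / 4 * d 1 - 7 / 6 * d 3 - 263 / 12 * d 4 + 211 / 6 * d 5 +
      173 / 6 * d 6 - 49 / 4 * d 7 - 49 / 4 * d 8 = 0 ∧
    -335 / 12 * d 1 + 7 / 6 * d 3 - 647 / 12 * d 6 + 103 / 3 * d 7 - 247 / 18 * d 8 = 0 ∧
    7 / 6 * d 2 - 335 / 12 * d 5 - 5 * d 6 - 111 / 4 * d 7 + 1805 / 36 * d 8 = 0 := by
  refine ⟨?_, ?_, ?_⟩
  · have := congrFun h 0
    simp only [bubbleTop, Finset.sum_apply, Pi.smul_apply, smul_eq_mul, jac_mulVec_apply] at this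
    simp [Fin.sum_univ_succ, refVertex_eq, numbering, bTop, baryDir_eq] at this
    linarith
  · have := congrFun h 1
    simp only [bubbleTop, Finset.sum_apply, Pi.smul_apply, smul_eq_mul, jac_mulVec_apply] at this
    simp [Fin.sum_univ_succ, refVertex_eq, numbering, bTop, baryDir_eq] at this
    linarith
  · have := congrFun h 2
    simp only [bubbleTop, Finset.sum_apply, Pi.smul_apply, smul_eq_mul, jac_mulVec_apply] at this
    simp [Fin.sum_univ_succ, refVertex_eq, numbering, bTop, baryDir_eq] at this
    linarith

theorem bubbleTop_xz {d : Fin 9 → ℝ} (h : bubbleTop d ![-1 / 20, 0, 1 / 20] = 0) :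
    -145 / 6 * d 0 - 49 / 4 * d 1 + 173 / 6 * d 2 + 211 / 6 * d 3 - 7 / 6 * d 4 -
      263 / 12 * d 5 + 17 / 3 * d 6 - 49 / 4 * d 7 - 29 / 4 * d 8 = 0 ∧
    -247 / 18 * d 0 - 111 / 4 * d 1 - 5 * d 2 - 335 / 12 * d 3 + 103 / 3 * d 6 +
      1805 / 36 * d 7 = 0 ∧
    -49 / 4 * d 0 + 17 / 3 * d 1 + 361 / 12 * d 2 - 29 / 4 * d 3 + 263 / 12 * d 5 -
      49 / 4 * d 6 - 145 / 6 * d 7 + 211 / 6 * d 8 = 0 := by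
  refine ⟨?_, ?_, ?_⟩
  · have := congrFun h 0
    simp only [bubbleTop, Finset.sum_apply, Pi.smul_apply, smul_eq_mul, jac_mulVec_apply] at this
    simp [Fin.sum_univ_succ, refVertex_eq, numbering, bTop, baryDir_eq] at this
    linarith
  · have := congrFun h 1
    simp only [bubbleTop, Finset.sum_apply, Pi.smul_apply, smul_eq_mul, jac_mulVec_apply] at this
    simp [Fin.sum_univ_succ, refVertex_eq, numbering, bTop, baryDir_eq] at this
    linarith
  · have := congrFun h 2
    simp only [bubbleTop, Finset.sum_apply, Pi.smul_apply, smul_eq_mul, jac_mulVec_apply] at this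
    simp [Fin.sum_univ_succ, refVertex_eq, numbering, bTop, baryDir_eq] at this
    linarith

theorem bubbleTop_xy {d : Fin 9 → ℝ} (h : bubbleTop d ![-1 / 20, 1 / 20, 0] = 0) :
    361 / 12 * d 0 - 49 / 4 * d 1 + 17 / 3 * d 2 - 263 / 12 * d 3 + 211 / 6 * d 4 -
      7 / 6 * d 5 - 29 / 4 * d 7 - 49 / 4 * d 8 = 0 ∧
    173 / 6 * d 0 - 145 / 6 * d 1 - 49 / 4 * d 2 + 263 / 12 * d 3 - 29 / 4 * d 4 -
      7 / 6 * d 6 + 211 / 6 * d 7 + 17 / 3 * d 8 = 0 ∧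
    -5 * d 0 - 247 / 18 * d 1 - 111 / 4 * d 2 + 7 / 6 * d 5 - 335 / 12 * d 7 +
      103 / 3 * d 8 = 0 := by
  refine ⟨?_, ?_, ?_⟩
  · have := congrFun h 0
    simp only [bubbleTop, Finset.sum_apply, Pi.smul_apply, smul_eq_mul, jac_mulVec_apply] at this
    simp [Fin.sum_univ_succ, refVertex_eq, numbering, bTop, baryDir_eq] at this
    linarith
  · have := congrFun h 1
    simp only [bubbleTop, Finset.sum_apply, Pi.smul_apply, smul_eq_mul, jac_mulVec_apply] at this
    simp [Fin.sum_univ_succ, refVertex_eq, numbering, bTop, baryDir_eq] at this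
    linarith
  · have := congrFun h 2
    simp only [bubbleTop, Finset.sum_apply, Pi.smul_apply, smul_eq_mul, jac_mulVec_apply] at this
    simp [Fin.sum_univ_succ, refVertex_eq, numbering, bTop, baryDir_eq] at this
    linarith

/-- The step `1 / 20` is small enough: four steps lower a barycentric coordinate by at most `1 / 5 <
1 / 4`, so all five sample points starting at the barycentre stay inside. -/
theorem baryDir_pos {w : R3} (h0 : w 0 = -1 / 20) (h1 : w 1 = 0 ∨ w 1 = 1 / 20)
    (h2 : w 2 = 0 ∨ w 2 = 1 / 20) (i : Fin 4) : 0 < 1 / 4 + 4 * baryDir w i := by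
  rw [baryDir_eq]
  rcases h1 with h1 | h1 <;> rcases h2 with h2 | h2 <;> fin_cases i <;>
    simp [h0, h1, h2] <;> norm_num

/-- The quartic parts of the nine bubbles are linearly independent. -/
theorem eq_zero_of_bubbleTop {d : Fin 9 → ℝ}
    (h : ∀ w : R3, (∀ i, 0 < 1 / 4 + 4 * baryDir w i) → bubbleTop d w = 0) : d = 0 := by
  obtain ⟨e1, e2, e3⟩ := bubbleTop_x (h _ (baryDir_pos rfl (Or.inl rfl) (Or.inl rfl)))
  obtain ⟨e4, e5, e6⟩ := bubbleTop_xz (h _ (baryDir_pos rfl (Or.inl rfl) (Or.inr rfl)))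
  obtain ⟨e7, e8, e9⟩ := bubbleTop_xy (h _ (baryDir_pos rfl (Or.inr rfl) (Or.inl rfl)))
  clear h
  -- The nine equations form a nonsingular rational system; each call finds a combination isolating
  -- one unknown, with the zeros already obtained at its disposal.
  have h8 : d 8 = 0 := by linarith
  have h7 : d 7 = 0 := by linarith
  have h6 : d 6 = 0 := by linarith
  have h5 : d 5 = 0 := by linarith
  have h4 : d 4 = 0 := by linarith
  have h3 : d 3 = 0 := by linarith
  have h2 : d 2 = 0 := by linarith
  have h1 : d 1 = 0 := by linarith
  have h0 : d 0 = 0 := by linarith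
  funext i
  fin_cases i
  exacts [h0, h1, h2, h3, h4, h5, h6, h7, h8]

end StokesP3

/-! ### Positive definiteness and uniqueness of the representation -/

namespace StokesP3

/-- The nine bubbles are linearly independent modulo cubic polynomials. -/
theorem eq_zero_of_add_piolaBubble_const {p : Fin 4 → R3} (hp : AffineIndependent ℝ p)
    {c : multiIdx → R3} {d : Fin 9 → ℝ} {v : R3}
    (h : ∀ x ∈ interior (convexHull ℝ (Set.range p)),
      ∑ k : multiIdx, localNodal p k x • c k + ∑ i, d i • piolaBubble (p ∘ numbering i) x = v) :
    d = 0 := by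
  refine eq_zero_of_bubbleTop fun w hw => ?_
  let L : ℝ → R3 := fun t => refMap p ((fun _ => 1 / 4) + t • w)
  have hL : ∀ t, 0 ≤ t → t ≤ 4 → L t ∈ interior (convexHull ℝ (Set.range p)) := by
    intro t h0 h4
    rw [mem_interior_convexHull_iff_bary hp]
    intro i
    rw [bary_refMap_line hp]
    -- The coordinate is affine in `t` and positive at `t = 0`; if it decreases, its minimum is at
    -- `t = 4`, where `hw` applies.
    rcases le_or_gt 0 (baryDir w i) with hb | hb
    · positivity
    · linarith [hw i, mul_le_mul_of_nonpos_right h4 hb.le]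
  have hdiff := fourthDiff_eq_zero_of_const fun t h0 h4 => h (L t) (hL t h0 h4)
  have hbub : ∀ i, fourthDiff (fun t => d i • piolaBubble (p ∘ numbering i) (L t)) =
      (24 : ℝ) • (jac p).mulVec (d i • (jac (refVertex ∘ numbering i)).mulVec
        (bTop fun j => baryDir w (numbering i j.succ))) := by
    intro i
    let σ : Equiv.Perm (Fin 4) :=
      Equiv.ofBijective _ (Finite.injective_iff_bijective.1 (numbering_injective i))
    have h1 := fourthDiff_piolaBubble hp σ w
    rw [Matrix.mulVec_smul, smul_comm]
    exact (fourthDiff_map (d i • (LinearMap.id : R3 →ₗ[ℝ] R3))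
      fun t => piolaBubble (p ∘ numbering i) (L t)).trans (congrArg (d i • ·) h1)
  rw [fourthDiff_add, fourthDiff_sum, fourthDiff_sum] at hdiff
  simp only [hbub, fourthDiff_smul_const] at hdiff
  -- The cubic terms disappear here; what is left is `24 • jac p` applied to `bubbleTop d w`, and
  -- `jac p` is invertible.
  rw [Finset.sum_eq_zero fun k _ => by rw [fourthDiff_localNodal hp k.2, zero_smul], zero_add,
    ← Finset.smul_sum, smul_eq_zero_iff_right (by norm_num), ← Matrix.mulVec_sum] at hdiff
  exact Matrix.eq_zero_of_mulVec_eq_zero (jac_det_isUnit hp).ne_zero hdiff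

namespace TetMesh

variable {n : ℕ} {M : TetMesh n}

/-- Coefficients of a function of zero energy vanish. -/
theorem eq_zero_of_gradForm_self {c : M.nodes → Fin 3 → ℝ} {d : Fin n → Fin 9 → ℝ}
    (hc : M.Admissible c) (h : M.gradForm (M.conformingPart c + M.bubblePart d)
      (M.conformingPart c + M.bubblePart d) = 0) : c = 0 ∧ d = 0 := by
  have hconst := (M.isPiecewiseC1_add c d).exists_eq_const_of_gradForm_self h
  have hd : d = 0 := funext fun t => by
    obtain ⟨w, hw⟩ := hconst t
    exact eq_zero_of_add_piolaBubble_const (M.affineIndependent t) fun x hx =>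
      (M.eqOn_localField c d t hx).symm.trans (hw x hx)
  refine ⟨eq_zero_of_conformingPart_const hc ?_, hd⟩
  have hb : M.bubblePart d = 0 := by simp [hd, bubblePart]
  simpa [hb] using hconst

variable (M) in
/-- The coefficients `(c, d)` determine `v_c + v_b` linearly. -/
theorem conformingPart_add_bubblePart_sub (c c' : M.nodes → Fin 3 → ℝ)
    (d d' : Fin n → Fin 9 → ℝ) :
    M.conformingPart (c - c') = M.conformingPart c - M.conformingPart c' ∧
      M.bubblePart (d - d') = M.bubblePart d - M.bubblePart d' := by
  simp only [conformingPart, bubblePart, Pi.sub_apply, sub_smul, Finset.sum_sub_distrib, and_self]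

theorem isPiecewiseC1_of_mem_Vh {v : R3 → R3} (hv : v ∈ M.Vh) : M.IsPiecewiseC1 v := by
  obtain ⟨c, d, -, rfl⟩ := hv
  exact M.isPiecewiseC1_add c d

/-- The coefficient differences represent the zero function, which has zero energy, and they are
again admissible. -/
theorem eq_of_representation_eq {c c' : M.nodes → Fin 3 → ℝ} {d d' : Fin n → Fin 9 → ℝ}
    (hc : M.Admissible c) (hc' : M.Admissible c')
    (h : M.conformingPart c + M.bubblePart d = M.conformingPart c' + M.bubblePart d') :
    c = c' ∧ d = d' := by
  obtain ⟨h1, h2⟩ := M.conformingPart_add_bubblePart_sub c c' d d'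
  have hadm : M.Admissible (c - c') := fun x hx => by
    rw [h1, Pi.sub_apply, hc x hx, hc' x hx, sub_zero]
  have hzero : M.conformingPart (c - c') + M.bubblePart (d - d') = 0 := by
    rw [h1, h2, sub_add_sub_comm, h, sub_self]
  have := eq_zero_of_gradForm_self hadm (d := d - d') (by
    rw [hzero, gradForm_eq]
    simp [gradDot])
  exact ⟨sub_eq_zero.1 this.1, sub_eq_zero.1 this.2⟩

variable (M) in
/-- The energy inner product on the nonconforming velocity space. -/
@[reducible] noncomputable def energyCore : InnerProductSpace.Core ℝ M.Vh where
  inner u v := M.gradForm u v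
  conj_inner_symm u v := M.gradForm_comm v u
  re_inner_nonneg u := M.gradForm_self_nonneg u
  add_left u v w := (isPiecewiseC1_of_mem_Vh u.2).gradForm_add_left
    (isPiecewiseC1_of_mem_Vh v.2) (isPiecewiseC1_of_mem_Vh w.2)
  smul_left u v r := (isPiecewiseC1_of_mem_Vh u.2).gradForm_smul_left r v
  definite := by
    rintro ⟨u, c, d, hc, rfl⟩ h
    obtain ⟨rfl, rfl⟩ := eq_zero_of_gradForm_self hc h
    ext1
    simp [conformingPart, bubblePart]

end TetMesh

end StokesP3

theorem lemma2p1 {n : ℕ} (M : StokesP3.TetMesh n) :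
    (∃ I : InnerProductSpace.Core ℝ M.Vh, ∀ u v : M.Vh, I.inner u v = M.gradForm u v) ∧
    (∀ (c : M.nodes → Fin 3 → ℝ) (d : Fin n → Fin 9 → ℝ), M.Admissible c →
      ¬ (c = 0 ∧ d = 0) →
      0 < M.gradForm (M.conformingPart c + M.bubblePart d)
        (M.conformingPart c + M.bubblePart d)) ∧
    (∀ v ∈ M.Vh, ∃! cd : (M.nodes → Fin 3 → ℝ) × (Fin n → Fin 9 → ℝ),
      M.Admissible cd.1 ∧ v = M.conformingPart cd.1 + M.bubblePart cd.2) := by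
  refine ⟨⟨M.energyCore, fun _ _ => rfl⟩, fun c d hc hne => ?_, ?_⟩
  · exact (M.gradForm_self_nonneg _).lt_of_ne' fun h =>
      hne (StokesP3.TetMesh.eq_zero_of_gradForm_self hc h)
  · rintro _ ⟨c, d, hc, rfl⟩
    refine ⟨(c, d), ⟨hc, rfl⟩, ?_⟩
    rintro ⟨c', d'⟩ ⟨hc', h⟩
    obtain ⟨rfl, rfl⟩ := StokesP3.TetMesh.eq_of_representation_eq hc hc' h
    rfl
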